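/- Let $p$ be a prime, let $m,r\ge 1$ be integers, let $G\cong (C_{p^r})^m$ be the direct product of $m$ cyclic groups of order $p^r$, and let $\mathbb F_q$ be a finite field with $q$ elements such that $p\nmid q$ and the class $\bar q$ has order $\varphi(p^r)$ in $U(\mathbb Z/p^r\mathbb Z)$. For a subgroup $H\le G$ put $\widehat H=\frac1{|H|}\sum_{x\in H}x\in\mathbb F_qG$, and for $x\in G$ put $\widehat x=\widehat{\langle x\rangle}$. A minimal code is a minimal nonzero ideal of $\mathbb F_qG$; its weight is the least number of nonzero coefficients of a nonzero element of it. Two codes are $G$-equivalent if the linear extension to $\mathbb F_qG$ of some automorphism of $G$ maps the first onto the second. Consider the elements $\widehat G$ and $e_{K,h,i}=\widehat K\,\bigl(\widehat{h^{p^i}}-\widehat{h^{p^{i-1}}}\bigr)$, where $1\le i\le r$, $K$ is a subgroup of $G$ isomorphic to $(C_{p^r})^{m-1}$, and $h\in G$ is an element of order $p^r$ with $G=\langle h\rangle\times K$. Then: 1. The primitive idempotents of $\mathbb F_qG$ are exactly $\widehat G$ and the elements $e_{K,h,i}$, and the minimal codes of $\mathbb F_qG$ are exactly the ideals generated by these idempotents.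 2. The code generated by $\widehat G$ has dimension $1$ and weight $p^{rm}$. The code generated by $e_{K,h,i}$ has dimension $p^{i-1}(p-1)$ and weight $2p^{r(m-1)+(r-i)}$. 3. The number of $G$-equivalence classes of minimal codes of $\mathbb F_qG$ is exactly $r+1=\tau(p^r)$, where $\tau(n)$ denotes the number of positive divisors of $n$. -/

import Mathlib

namespace AbelianCodes

/-- An idempotent `e ≠ 0` that is not a sum of two nonzero orthogonal idempotents. -/
def IsPrimitiveIdempotent {R : Type*} [Ring R] (e : R) : Prop :=
  IsIdempotentElem e ∧ e ≠ 0 ∧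
    ∀ a b : R, IsIdempotentElem a → IsIdempotentElem b → a * b = 0 → b * a = 0 →
      e = a + b → a = 0 ∨ b = 0

section

variable (F : Type*) [Field F] {G : Type*} [CommGroup G]

/-- `Ĥ = |H|⁻¹ ∑_{h ∈ H} h` in the group algebra, for a finite subgroup `H` of `G`. -/
noncomputable def hat (H : Subgroup G) : MonoidAlgebra F G :=
  (Nat.card H : F)⁻¹ • ∑ᶠ h : H, MonoidAlgebra.single (h : G) (1 : F)

/-- `K̂ · (\widehat{h^{p^i}} - \widehat{h^{p^{i-1}}})`, where `x̂` is the hat of the cyclic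
subgroup generated by `x`; it is used for `1 ≤ i` only. -/
noncomputable def rowIdempotent (p : ℕ) (K : Subgroup G) (h : G) (i : ℕ) : MonoidAlgebra F G :=
  hat F K * (hat F (Subgroup.zpowers (h ^ p ^ i)) - hat F (Subgroup.zpowers (h ^ p ^ (i - 1))))

end

/-- `G` is isomorphic to the direct product of `k` copies of the cyclic group of order `n`. -/
def IsHomocyclic (n k : ℕ) (G : Type*) [Group G] : Prop :=
  Nonempty (G ≃* (Fin k → Multiplicative (ZMod n)))

/-- `K` is isomorphic to `(C_n)^(m-1)`, `⟨h⟩ ≅ C_n`, and `G` is the internal direct product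
`⟨h⟩ × K` (in an abelian group: `⟨h⟩ K = G` and `⟨h⟩ ∩ K = 1`). -/
def IsSplitting (n m : ℕ) {G : Type*} [CommGroup G] (K : Subgroup G) (h : G) : Prop :=
  IsHomocyclic n (m - 1) K ∧ orderOf h = n ∧ IsCompl (Subgroup.zpowers h) K

section

variable {F : Type*} [Field F] {G : Type*} [CommGroup G]

/-- A minimal code: a minimal nonzero ideal of the group algebra. -/
def IsMinimalCode (I : Ideal (MonoidAlgebra F G)) : Prop := IsAtom I

/-- The dimension of a code over `F`. -/
noncomputable def codeDim (I : Ideal (MonoidAlgebra F G)) : ℕ :=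
  Module.finrank F (I.restrictScalars F)

/-- The Hamming weight of an element of the group algebra: the size of its support. -/
def hammingWeight (x : MonoidAlgebra F G) : ℕ := x.coeff.support.card

/-- `w` is the weight of the code `I`: the least Hamming weight of a nonzero element. -/
def HasWeight (I : Ideal (MonoidAlgebra F G)) (w : ℕ) : Prop :=
  IsLeast {k : ℕ | ∃ x ∈ I, x ≠ 0 ∧ hammingWeight x = k} w

/-- Two codes are `G`-equivalent if the linear extension of some automorphism of `G` maps the
first onto the second. -/
def GEquivalent (I J : Ideal (MonoidAlgebra F G)) : Prop :=
  ∃ ψ : G ≃* G, MonoidAlgebra.domCongr F F ψ '' (I : Set (MonoidAlgebra F G)) = J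

theorem GEquivalent.refl (I : Ideal (MonoidAlgebra F G)) : GEquivalent I I :=
  ⟨MulEquiv.refl G, by simp⟩

theorem GEquivalent.symm {I J : Ideal (MonoidAlgebra F G)} (h : GEquivalent I J) :
    GEquivalent J I := by
  obtain ⟨ψ, hψ⟩ := h
  refine ⟨ψ.symm, ?_⟩
  rw [← hψ, ← MonoidAlgebra.domCongr_symm, Set.image_image]
  simp only [AlgEquiv.symm_apply_apply, Set.image_id']

theorem GEquivalent.trans {I J L : Ideal (MonoidAlgebra F G)} (h : GEquivalent I J)
    (h' : GEquivalent J L) : GEquivalent I L := by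
  obtain ⟨ψ, hψ⟩ := h
  obtain ⟨χ, hχ⟩ := h'
  refine ⟨ψ.trans χ, ?_⟩
  rw [← hχ, ← hψ, ← MonoidAlgebra.trans_domCongr_domCongr, Set.image_image]
  rfl

end

/-- `G`-equivalence on the set of minimal codes of the group algebra `F G`. -/
def minimalCodeSetoid (F : Type*) [Field F] (G : Type*) [CommGroup G] :
    Setoid {I : Ideal (MonoidAlgebra F G) // IsMinimalCode I} where
  r I J := GEquivalent I.1 J.1
  iseqv := ⟨fun I => GEquivalent.refl I.1, GEquivalent.symm, GEquivalent.trans⟩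

end AbelianCodes

/-! Two facts suffice: every candidate idempotent generates a minimal ideal, and no nonzero element
is killed by all candidates. In a commutative ring these already pin down all minimal ideals and all
primitive idempotents.

Minimality (`isAtom_span_rowIdempotent`): K acts trivially on e = e_{K,h,i}, so the ideal of e is
F[h]e, a copy of F[X]/(Φ_{p^i}). As q generates the units modulo p^i, Φ_{p^i} is irreducible over F;
hence this is a field of degree φ(p^i).

Completeness (`exists_mul_ne_zero`): a maximal ideal above the annihilator of x gives a character of
G with values in a field. After a change of basis it is trivial on K and has order p^i at h, so the
matching candidate maps to 1 and cannot kill x.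

With H = K⟨h^{p^i}⟩, code elements are constant on cosets of H and have coefficient sum zero, so a
nonzero one meets at least two cosets. Automorphisms act transitively on splittings (K, h), and the
weight separates the values of i: one class for each i, plus that of Ĝ. -/

namespace AbelianCodes

open MonoidAlgebra

/-! ### Averages over subgroups -/

section hat

variable {F : Type*} [Field F] {G : Type*} [CommGroup G]

theorem coeff_hat [Finite G] (H : Subgroup G) (g : G) [Decidable (g ∈ H)] :
    (hat F H).coeff g = if g ∈ H then (Nat.card H : F)⁻¹ else 0 := by
  classical
  have := Fintype.ofFinite H
  rw [hat, finsum_eq_sum_of_fintype, coeff_smul, coeff_sum, Finsupp.smul_apply,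
    Finsupp.finsetSum_apply]
  simp only [coeff_single, Finsupp.single_apply, smul_eq_mul]
  split_ifs with hg
  · rw [Finset.sum_eq_single_of_mem ⟨g, hg⟩ (Finset.mem_univ _)]
    · simp
    · intro b _ hb
      rw [if_neg]
      rintro rfl
      exact hb rfl
  · rw [Finset.sum_eq_zero, mul_zero]
    intro b _
    rw [if_neg]
    rintro rfl
    exact hg b.2

theorem coeff_single_one_mul (g h : G) (x : MonoidAlgebra F G) :
    (single g (1 : F) * x).coeff h = x.coeff (g⁻¹ * h) := by
  rw [coeff_single_mul_apply, one_mul]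

theorem single_mul_hat [Finite G] {H : Subgroup G} {k : G} (hk : k ∈ H) :
    single k (1 : F) * hat F H = hat F H := by
  classical
  ext g
  rw [coeff_single_one_mul, coeff_hat, coeff_hat]
  simp only [H.mul_mem_cancel_left (H.inv_mem hk)]

/-- The subgroup of the group elements that fix `y` under multiplication. -/
def fixer (y : MonoidAlgebra F G) : Subgroup G where
  carrier := {g | single g (1 : F) * y = y}
  one_mem' := by
    rw [Set.mem_ofPred_eq, ← one_def, one_mul]
  mul_mem' {a b} ha hb := by
    rw [Set.mem_ofPred_eq] at *
    rw [← one_mul (1 : F), ← single_mul_single, mul_assoc, hb, ha]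
  inv_mem' {a} ha := by
    rw [Set.mem_ofPred_eq] at *
    nth_rw 1 [← ha]
    rw [← mul_assoc, single_mul_single, inv_mul_cancel, one_mul, ← one_def, one_mul]

theorem mem_fixer {y : MonoidAlgebra F G} {g : G} : g ∈ fixer y ↔ single g (1 : F) * y = y :=
  Iff.rfl

theorem fixer_mul_le (x y : MonoidAlgebra F G) : fixer y ≤ fixer (x * y) := by
  intro g hg
  rw [mem_fixer] at *
  rw [mul_left_comm, hg]

theorem le_fixer_hat [Finite G] (H : Subgroup G) : H ≤ fixer (hat F H) :=
  fun _ hk => single_mul_hat hk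

theorem natCast_card_subgroup_ne_zero (hG : (Nat.card G : F) ≠ 0) (H : Subgroup G) :
    (Nat.card H : F) ≠ 0 := by
  intro h
  obtain ⟨c, hc⟩ := H.card_subgroup_dvd_card
  exact hG (by rw [hc, Nat.cast_mul, h, zero_mul])

/-- Averaging over H does nothing to an element that H already fixes. -/
theorem hat_mul_of_le_fixer [Finite G] (hG : (Nat.card G : F) ≠ 0) {H : Subgroup G}
    {y : MonoidAlgebra F G} (hy : H ≤ fixer y) : hat F H * y = y := by
  have := Fintype.ofFinite H
  rw [hat, finsum_eq_sum_of_fintype, smul_mul_assoc, Finset.sum_mul,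
    Finset.sum_congr rfl fun k _ => mem_fixer.1 (hy k.2), Finset.sum_const, Finset.card_univ,
    ← Nat.card_eq_fintype_card, ← Nat.cast_smul_eq_nsmul F, smul_smul,
    inv_mul_cancel₀ (natCast_card_subgroup_ne_zero hG H), one_smul]

theorem hat_mul_hat_of_le [Finite G] (hG : (Nat.card G : F) ≠ 0) {H K : Subgroup G} (h : H ≤ K) :
    hat F H * hat F K = hat F K :=
  hat_mul_of_le_fixer hG (h.trans (le_fixer_hat K))

/-- The product is fixed by H and by K, hence absorbs the hat of H ⊔ K; that hat in turn absorbs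
both factors. -/
theorem hat_mul_hat [Finite G] (hG : (Nat.card G : F) ≠ 0) (H K : Subgroup G) :
    hat F H * hat F K = hat F (H ⊔ K) := by
  have h1 : hat F (H ⊔ K) * (hat F H * hat F K) = hat F H * hat F K := by
    refine hat_mul_of_le_fixer hG (sup_le ?_ ?_)
    · rw [mul_comm]
      exact (le_fixer_hat H).trans (fixer_mul_le _ _)
    · exact (le_fixer_hat K).trans (fixer_mul_le _ _)
  rw [← h1, mul_comm, mul_assoc, hat_mul_hat_of_le hG le_sup_right,
    hat_mul_hat_of_le hG le_sup_left]

theorem domCongr_hat [Finite G] (ψ : G ≃* G) (H : Subgroup G) :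
    domCongr F F ψ (hat F H) = hat F (H.map ψ.toMonoidHom) := by
  classical
  ext g
  have hc : Nat.card (H.map ψ.toMonoidHom) = Nat.card H :=
    (Nat.card_congr (H.equivMapOfInjective ψ.toMonoidHom ψ.injective).toEquiv).symm
  rw [coeff_domCongr, coeff_hat, coeff_hat, hc]
  refine if_congr ?_ rfl rfl
  exact Subgroup.mem_map_equiv.symm

theorem domCongr_rowIdempotent [Finite G] (ψ : G ≃* G) (p : ℕ) (K : Subgroup G) (h : G) (i : ℕ) :
    domCongr F F ψ (rowIdempotent F p K h i) =
      rowIdempotent F p (K.map ψ.toMonoidHom) (ψ h) i := by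
  simp only [rowIdempotent, map_mul, map_sub, domCongr_hat, MonoidHom.map_zpowers]
  simp

theorem hat_ne_zero [Finite G] (hG : (Nat.card G : F) ≠ 0) (H : Subgroup G) : hat F H ≠ 0 := by
  classical
  intro h
  have := coeff_hat (F := F) H 1
  rw [h, if_pos H.one_mem] at this
  exact inv_ne_zero (natCast_card_subgroup_ne_zero hG H) (by simpa using this.symm)

theorem isIdempotentElem_hat [Finite G] (hG : (Nat.card G : F) ≠ 0) (H : Subgroup G) :
    IsIdempotentElem (hat F H) := hat_mul_hat_of_le hG le_rfl

theorem rowIdempotent_eq [Finite G] (hG : (Nat.card G : F) ≠ 0) (p : ℕ) (K : Subgroup G) (h : G)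
    (i : ℕ) : rowIdempotent F p K h i = hat F (K ⊔ Subgroup.zpowers (h ^ p ^ i)) -
      hat F (K ⊔ Subgroup.zpowers (h ^ p ^ (i - 1))) := by
  rw [rowIdempotent, mul_sub, hat_mul_hat hG, hat_mul_hat hG]

theorem sup_zpowers_le (p : ℕ) (K : Subgroup G) (h : G) (i : ℕ) :
    K ⊔ Subgroup.zpowers (h ^ p ^ i) ≤ K ⊔ Subgroup.zpowers (h ^ p ^ (i - 1)) := by
  refine sup_le_sup_left ?_ K
  rw [Subgroup.zpowers_le]
  obtain ⟨c, hc⟩ := pow_dvd_pow p (Nat.sub_le i 1)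
  rw [hc, pow_mul]
  exact Subgroup.pow_mem _ (Subgroup.mem_zpowers _) _

theorem isIdempotentElem_rowIdempotent [Finite G] (hG : (Nat.card G : F) ≠ 0) (p : ℕ)
    (K : Subgroup G) (h : G) (i : ℕ) : IsIdempotentElem (rowIdempotent F p K h i) := by
  have h1 := hat_mul_hat_of_le hG (sup_zpowers_le p K h i)
  rw [IsIdempotentElem, rowIdempotent_eq hG, sub_mul, mul_sub, mul_sub, h1,
    isIdempotentElem_hat hG, isIdempotentElem_hat hG, mul_comm, h1, sub_self, sub_zero]

/-- The augmentation map of the group algebra. -/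
noncomputable def augmentation : MonoidAlgebra F G →ₐ[F] F := MonoidAlgebra.lift F F G 1

theorem augmentation_single (g : G) (a : F) : augmentation (single g a) = a := by
  simp [augmentation]

theorem augmentation_eq_sum [Fintype G] (x : MonoidAlgebra F G) :
    augmentation x = ∑ g, x.coeff g := by
  rw [augmentation, MonoidAlgebra.lift_apply, Finsupp.sum_fintype] <;> simp

theorem map_hat_eq_one_of_forall {R : Type*} [CommRing R] [Finite G] (hG : (Nat.card G : F) ≠ 0)
    (H : Subgroup G) (φ : MonoidAlgebra F G →+* R) (hφ : ∀ k ∈ H, φ (single k 1) = 1) :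
    φ (hat F H) = 1 := by
  have := Fintype.ofFinite H
  -- `φ` is only a ring homomorphism, so the scalar |H|⁻¹ is rewritten as an element of the group
  -- algebra.
  have h1 : hat F H = single 1 (Nat.card H : F)⁻¹ * ∑ k : H, single k.1 (1 : F) := by
    rw [hat, finsum_eq_sum_of_fintype, ← smul_one_mul, one_def, smul_single, smul_eq_mul, mul_one]
  rw [h1, map_mul, map_sum, Finset.sum_congr rfl fun k _ => hφ k.1 k.2, Finset.sum_const,
    Finset.card_univ, ← Nat.card_eq_fintype_card, nsmul_one, ← map_natCast φ, natCast_def,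
    ← map_mul, single_mul_single, inv_mul_cancel₀ (natCast_card_subgroup_ne_zero hG H), one_mul,
    ← one_def, map_one]

end hat

/-! ### The code of constant vectors -/

section topHat

variable {F : Type*} [Field F] {G : Type*} [CommGroup G]

theorem mul_hat_top [Finite G] (x : MonoidAlgebra F G) :
    x * hat F (⊤ : Subgroup G) = augmentation x • hat F (⊤ : Subgroup G) := by
  induction x using MonoidAlgebra.induction_linear with
  | zero => simp
  | add x y hx hy => rw [add_mul, hx, hy, map_add, add_smul]
  | single g a =>
    rw [augmentation_single, show single g a = a • single g (1 : F) by simp, smul_mul_assoc,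
      single_mul_hat (Subgroup.mem_top g)]

theorem mem_span_hat_top [Finite G] {x : MonoidAlgebra F G} :
    x ∈ Ideal.span {hat F (⊤ : Subgroup G)} ↔ ∃ a : F, a • hat F (⊤ : Subgroup G) = x := by
  rw [Ideal.mem_span_singleton']
  constructor
  · rintro ⟨y, rfl⟩
    exact ⟨_, (mul_hat_top y).symm⟩
  · rintro ⟨a, rfl⟩
    exact ⟨a • 1, by rw [smul_mul_assoc, one_mul]⟩

theorem isAtom_span_singleton {R : Type*} [CommRing R] {e : R} (he : e ≠ 0)
    (h : ∀ x : R, x * e ≠ 0 → e ∈ Ideal.span {x * e}) : IsAtom (Ideal.span {e}) := by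
  refine ⟨by simpa using he, fun I hI => ?_⟩
  by_contra hne
  obtain ⟨y, hy, hy0⟩ := Submodule.exists_mem_ne_zero_of_ne_bot hne
  obtain ⟨x, rfl⟩ := Ideal.mem_span_singleton'.1 (hI.le hy)
  refine hI.not_ge ?_
  rw [Ideal.span_singleton_le_iff_mem]
  exact (Ideal.span_singleton_le_iff_mem I).2 hy (h x hy0)

theorem isAtom_span_hat_top [Finite G] (hG : (Nat.card G : F) ≠ 0) :
    IsAtom (Ideal.span {hat F (⊤ : Subgroup G)}) := by
  refine isAtom_span_singleton (hat_ne_zero hG _) fun x hx => ?_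
  rw [mul_hat_top] at hx ⊢
  have ha : augmentation x ≠ 0 := left_ne_zero_of_smul hx
  rw [Ideal.mem_span_singleton']
  exact ⟨(augmentation x)⁻¹ • 1, by rw [smul_mul_assoc, one_mul, inv_smul_smul₀ ha]⟩

theorem codeDim_span_hat_top [Finite G] (hG : (Nat.card G : F) ≠ 0) :
    codeDim (Ideal.span {hat F (⊤ : Subgroup G)}) = 1 := by
  have : (Ideal.span {hat F (⊤ : Subgroup G)}).restrictScalars F =
      Submodule.span F {hat F (⊤ : Subgroup G)} := by
    ext x
    rw [Submodule.restrictScalars_mem, mem_span_hat_top, Submodule.mem_span_singleton]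
  rw [codeDim, this, finrank_span_singleton (hat_ne_zero hG _)]

theorem hasWeight_span_hat_top [Finite G] (hG : (Nat.card G : F) ≠ 0) :
    HasWeight (Ideal.span {hat F (⊤ : Subgroup G)}) (Nat.card G) := by
  classical
  have := Fintype.ofFinite G
  have key : ∀ a : F, a ≠ 0 → hammingWeight (a • hat F (⊤ : Subgroup G)) = Nat.card G := by
    intro a ha
    rw [hammingWeight, Nat.card_eq_fintype_card, ← Finset.card_univ]
    congr 1
    ext g
    have hG' : (Fintype.card G : F) ≠ 0 := by rwa [← Nat.card_eq_fintype_card]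
    simp [coeff_hat, ha, hG']
  constructor
  · refine ⟨_, Ideal.mem_span_singleton_self _, hat_ne_zero hG _, ?_⟩
    simpa using key 1 one_ne_zero
  · rintro _ ⟨x, hx, hx0, rfl⟩
    obtain ⟨a, rfl⟩ := mem_span_hat_top.1 hx
    exact (key a (left_ne_zero_of_smul hx0)).ge

end topHat

/-! ### Irreducibility of cyclotomic polynomials -/

section irreducible

/-- Order φ(a) means that q generates the units modulo a; reduction to the units modulo b is
surjective, so it preserves generators. -/
theorem orderOf_unitOfCoprime_of_dvd {q a b : ℕ} [NeZero a] (hab : b ∣ a) (ha : q.Coprime a)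
    (hb : q.Coprime b) (ho : orderOf (ZMod.unitOfCoprime q ha) = a.totient) :
    orderOf (ZMod.unitOfCoprime q hb) = b.totient := by
  have : NeZero b := ⟨fun h => NeZero.ne a (by simpa [h] using hab)⟩
  have htop : Subgroup.zpowers (ZMod.unitOfCoprime q ha) = ⊤ := by
    apply Subgroup.eq_top_of_card_eq
    rw [Nat.card_zpowers, ho, Nat.card_eq_fintype_card, ZMod.card_units_eq_totient]
  have hmap : ZMod.unitsMap hab (ZMod.unitOfCoprime q ha) = ZMod.unitOfCoprime q hb := by
    ext
    simp [ZMod.unitsMap_val, ZMod.cast_natCast hab]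
  rw [← Nat.card_zpowers, ← hmap, ← MonoidHom.map_zpowers, htop, ← MonoidHom.range_eq_map,
    MonoidHom.range_eq_top.2 (ZMod.unitsMap_surjective hab), Subgroup.card_top,
    Nat.card_eq_fintype_card, ZMod.card_units_eq_totient]

/-- Irreducible factors of Φ_n over F have degree the order of q modulo n, which here is the full
degree φ(n). -/
theorem irreducible_cyclotomic_of_orderOf {F : Type*} [Field F] [Finite F] {q n : ℕ}
    (hF : Nat.card F = q) (hq : q.Coprime n)
    (ho : orderOf (ZMod.unitOfCoprime q hq) = n.totient) :
    Irreducible (Polynomial.cyclotomic n F) := by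
  have := Fintype.ofFinite F
  obtain ⟨ℓ, hℓ⟩ := CharP.exists F
  obtain ⟨f, hprime, hcard⟩ := FiniteField.card F ℓ
  have : Fact ℓ.Prime := ⟨hprime⟩
  obtain rfl : q = ℓ ^ (f : ℕ) := by rw [← hF, Nat.card_eq_fintype_card, hcard]
  have hn : ℓ.Coprime n := (Nat.coprime_pow_left_iff f.pos _ _).1 hq
  refine Polynomial.irreducible_of_dvd_cyclotomic_of_natDegree hcard hn dvd_rfl ?_
  rw [Polynomial.natDegree_cyclotomic, ho]

end irreducible

/-! ### Subgroup orders in a splitting -/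

section splitting

variable {G : Type*} [CommGroup G]

theorem IsHomocyclic.card_eq {n k : ℕ} (h : IsHomocyclic n k G) : Nat.card G = n ^ k := by
  obtain ⟨f⟩ := h
  rw [Nat.card_congr f.toEquiv, Nat.card_fun, Nat.card_congr Multiplicative.toAdd, Nat.card_zmod,
    Nat.card_fin]

theorem card_sup_of_disjoint {H K : Subgroup G} (h : Disjoint H K) :
    Nat.card (H ⊔ K : Subgroup G) = Nat.card H * Nat.card K := by
  have h1 := Subgroup.relIndex_mul_relIndex ⊥ K (H ⊔ K) bot_le le_sup_right
  rw [Subgroup.relIndex_bot_left, Subgroup.relIndex_bot_left, Subgroup.relIndex_sup_right,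
    ← Subgroup.inf_relIndex_right, h.symm.eq_bot, Subgroup.relIndex_bot_left] at h1
  rw [← h1, mul_comm]

theorem IsSplitting.card_sup {p r m : ℕ} (hp : p.Prime) {K : Subgroup G} {h : G}
    (hs : IsSplitting (p ^ r) m K h) {i : ℕ} (hi : i ≤ r) :
    Nat.card (K ⊔ Subgroup.zpowers (h ^ p ^ i) : Subgroup G) = p ^ (r * (m - 1) + (r - i)) := by
  obtain ⟨hK, ho, hc⟩ := hs
  have hle : Subgroup.zpowers (h ^ p ^ i) ≤ Subgroup.zpowers h :=
    Subgroup.zpowers_le.2 (Subgroup.pow_mem _ (Subgroup.mem_zpowers h) _)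
  rw [card_sup_of_disjoint (hc.disjoint.mono_left hle).symm, hK.card_eq, Nat.card_zpowers,
    orderOf_pow_of_dvd (pow_ne_zero _ hp.ne_zero) (ho ▸ pow_dvd_pow p hi), ho,
    Nat.pow_div hi hp.pos, ← pow_mul, ← pow_add]

theorem IsSplitting.notMem_sup {p r m : ℕ} (hp : p.Prime) {K : Subgroup G} {h : G}
    (hs : IsSplitting (p ^ r) m K h) {i : ℕ} (hi1 : 1 ≤ i) (hi : i ≤ r) :
    h ^ p ^ (i - 1) ∉ K ⊔ Subgroup.zpowers (h ^ p ^ i) := by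
  intro hmem
  have hle : K ⊔ Subgroup.zpowers (h ^ p ^ (i - 1)) ≤ K ⊔ Subgroup.zpowers (h ^ p ^ i) :=
    sup_le le_sup_left (Subgroup.zpowers_le.2 hmem)
  have h1 := hs.card_sup hp hi
  rw [← le_antisymm hle (sup_zpowers_le p K h i), hs.card_sup hp ((Nat.sub_le i 1).trans hi)] at h1
  have := Nat.pow_right_injective hp.two_le h1
  omega

theorem IsSplitting.exists_mul_pow {n m : ℕ} [NeZero n] {K : Subgroup G} {h : G}
    (hs : IsSplitting n m K h) (g : G) : ∃ k ∈ K, ∃ t : ℕ, g = h ^ t * k := by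
  obtain ⟨-, ho, hc⟩ := hs
  have hg : g ∈ Subgroup.zpowers h ⊔ K := hc.sup_eq_top ▸ Subgroup.mem_top g
  obtain ⟨x, hx, k, hk, rfl⟩ := Subgroup.mem_sup.1 hg
  have hfin : IsOfFinOrder h := orderOf_pos_iff.1 (ho ▸ Nat.pos_of_neZero n)
  obtain ⟨t, rfl⟩ := hfin.mem_powers_iff_mem_zpowers.2 hx
  exact ⟨k, hk, t, rfl⟩

end splitting

/-! ### The codes of e_{K,h,i}: minimality, dimension, weight -/

section row

variable {F : Type*} [Field F] {G : Type*} [CommGroup G] [Finite G]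

theorem rowIdempotent_ne_zero (hG : (Nat.card G : F) ≠ 0) {p r m : ℕ} (hp : p.Prime)
    {K : Subgroup G} {h : G} (hs : IsSplitting (p ^ r) m K h) {i : ℕ} (hi1 : 1 ≤ i) (hi : i ≤ r) :
    rowIdempotent F p K h i ≠ 0 := by
  classical
  rw [rowIdempotent_eq hG]
  intro h0
  have h1 := congrArg (fun x => x.coeff (h ^ p ^ (i - 1))) (sub_eq_zero.1 h0)
  simp only [coeff_hat] at h1
  rw [if_neg (hs.notMem_sup hp hi1 hi),
    if_pos ((le_sup_right : _ ≤ K ⊔ _) (Subgroup.mem_zpowers _))] at h1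
  exact inv_ne_zero (natCast_card_subgroup_ne_zero hG _) h1.symm

theorem le_fixer_rowIdempotent (p : ℕ) (K : Subgroup G) (h : G) (i : ℕ) :
    K ≤ fixer (rowIdempotent F p K h i) := by
  rw [rowIdempotent, mul_comm]
  exact (le_fixer_hat K).trans (fixer_mul_le _ _)

/-- Put y = h^{p^{i-1}}. Then Φ_{p^i}(h) = T = 1 + y + ⋯ + y^{p-1}, which does not distinguish the
averages A over ⟨y^p⟩ and B over ⟨y⟩: TA is fixed by y, so TA = BTA = TB. -/
theorem aeval_cyclotomic_mul_rowIdempotent (hG : (Nat.card G : F) ≠ 0) {p : ℕ} (hp : p.Prime)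
    (K : Subgroup G) (h : G) {i : ℕ} (hi1 : 1 ≤ i) :
    Polynomial.aeval (single h (1 : F)) (Polynomial.cyclotomic (p ^ i) F) *
      rowIdempotent F p K h i = 0 := by
  obtain ⟨j, rfl⟩ : ∃ j, i = j + 1 := ⟨i - 1, by omega⟩
  set A := hat F (Subgroup.zpowers (h ^ p ^ (j + 1)))
  set B := hat F (Subgroup.zpowers (h ^ p ^ j))
  set T := ∑ s ∈ Finset.range p, single (h ^ p ^ j) (1 : F) ^ s
  have hT : Polynomial.aeval (single h (1 : F)) (Polynomial.cyclotomic (p ^ (j + 1)) F) = T := by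
    simp [T, Polynomial.cyclotomic_prime_pow_eq_geom_sum hp, single_pow]
  have hgeom : T * (single (h ^ p ^ j) (1 : F) - 1) = single (h ^ p ^ (j + 1)) (1 : F) - 1 := by
    rw [geom_sum_mul, single_pow, one_pow, ← pow_mul, pow_succ]
  -- (y - 1)TA = (y^p - 1)A = 0, since y^p fixes A.
  have hfix : Subgroup.zpowers (h ^ p ^ j) ≤ fixer (T * A) := by
    rw [Subgroup.zpowers_le, mem_fixer, ← sub_eq_zero]
    have h1 : single (h ^ p ^ (j + 1)) (1 : F) * A = A := single_mul_hat (Subgroup.mem_zpowers _)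
    linear_combination A * hgeom + h1
  have hAB : A * B = B := by
    refine hat_mul_hat_of_le hG ?_
    rw [Subgroup.zpowers_le, pow_succ, pow_mul]
    exact Subgroup.pow_mem _ (Subgroup.mem_zpowers _) _
  have hTA := hat_mul_of_le_fixer hG hfix
  have hz : T * (A - B) = 0 := by
    change B * (T * A) = T * A at hTA
    linear_combination T * hAB - hTA
  rw [hT, rowIdempotent, Nat.add_sub_cancel, mul_left_comm]
  change _ * (T * (A - B)) = 0
  rw [hz, mul_zero]

/-- Writing g = h^t k with k in K, the factor k disappears on e, leaving only polynomials in h. -/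
theorem exists_aeval_mul_rowIdempotent {n m : ℕ} [NeZero n] {p : ℕ} {K : Subgroup G} {h : G}
    (hs : IsSplitting n m K h) (i : ℕ) (x : MonoidAlgebra F G) :
    ∃ f : Polynomial F, x * rowIdempotent F p K h i =
      Polynomial.aeval (single h (1 : F)) f * rowIdempotent F p K h i := by
  induction x using MonoidAlgebra.induction_linear with
  | zero => exact ⟨0, by simp⟩
  | add x y hx hy =>
    obtain ⟨f, hf⟩ := hx
    obtain ⟨g, hg⟩ := hy
    exact ⟨f + g, by rw [add_mul, hf, hg, map_add, add_mul]⟩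
  | single g a =>
    obtain ⟨k, hk, t, rfl⟩ := hs.exists_mul_pow g
    refine ⟨Polynomial.C a * Polynomial.X ^ t, ?_⟩
    have h1 : single (h ^ t * k) a = (a • single h (1 : F) ^ t) * single k (1 : F) := by
      rw [single_pow, smul_single, single_mul_single]
      simp
    rw [h1, mul_assoc, mem_fixer.1 (le_fixer_rowIdempotent p K h i hk)]
    simp [Polynomial.aeval_C, Algebra.smul_def]

/-- Bézout: uΦ + vf = 1 evaluated at h makes v(h) an inverse of f(h) on e, because Φ(h) kills e. -/
theorem exists_mul_aeval_mul_rowIdempotent (hG : (Nat.card G : F) ≠ 0) {p : ℕ} (hp : p.Prime)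
    {K : Subgroup G} {h : G} {i : ℕ} (hi1 : 1 ≤ i)
    (hirr : Irreducible (Polynomial.cyclotomic (p ^ i) F)) {f : Polynomial F}
    (hf : ¬ Polynomial.cyclotomic (p ^ i) F ∣ f) :
    ∃ y : MonoidAlgebra F G, y * (Polynomial.aeval (single h (1 : F)) f *
      rowIdempotent F p K h i) = rowIdempotent F p K h i := by
  obtain ⟨u, v, huv⟩ := (hirr.coprime_iff_not_dvd).2 hf
  refine ⟨Polynomial.aeval (single h (1 : F)) v, ?_⟩
  have h1 := congrArg (Polynomial.aeval (single h (1 : F))) huv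
  rw [map_add, map_mul, map_mul, map_one] at h1
  have h2 := aeval_cyclotomic_mul_rowIdempotent hG hp K h hi1
  linear_combination rowIdempotent F p K h i * h1 -
    Polynomial.aeval (single h (1 : F)) u * h2

theorem isAtom_span_rowIdempotent (hG : (Nat.card G : F) ≠ 0) {p r m : ℕ} (hp : p.Prime)
    {K : Subgroup G} {h : G} (hs : IsSplitting (p ^ r) m K h) {i : ℕ} (hi1 : 1 ≤ i) (hi : i ≤ r)
    (hirr : Irreducible (Polynomial.cyclotomic (p ^ i) F)) :
    IsAtom (Ideal.span {rowIdempotent F p K h i}) := by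
  have : NeZero (p ^ r) := ⟨pow_ne_zero _ hp.ne_zero⟩
  refine isAtom_span_singleton (rowIdempotent_ne_zero hG hp hs hi1 hi) fun x hx => ?_
  obtain ⟨f, hf⟩ := exists_aeval_mul_rowIdempotent hs i x
  rw [hf] at hx ⊢
  rw [Ideal.mem_span_singleton']
  refine exists_mul_aeval_mul_rowIdempotent hG hp hi1 hirr ?_
  rintro ⟨g, rfl⟩
  apply hx
  rw [map_mul, mul_right_comm, aeval_cyclotomic_mul_rowIdempotent hG hp K h hi1, zero_mul]

theorem codeDim_span_rowIdempotent (hG : (Nat.card G : F) ≠ 0) {p r m : ℕ} (hp : p.Prime)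
    {K : Subgroup G} {h : G} (hs : IsSplitting (p ^ r) m K h) {i : ℕ} (hi1 : 1 ≤ i) (hi : i ≤ r)
    (hirr : Irreducible (Polynomial.cyclotomic (p ^ i) F)) :
    codeDim (Ideal.span {rowIdempotent F p K h i}) = p ^ (i - 1) * (p - 1) := by
  have : NeZero (p ^ r) := ⟨pow_ne_zero _ hp.ne_zero⟩
  have hne := rowIdempotent_ne_zero (F := F) hG hp hs hi1 hi
  set e := rowIdempotent F p K h i
  let L : Polynomial F →ₗ[F] MonoidAlgebra F G :=
    (LinearMap.mulRight F e).comp (Polynomial.aeval (single h (1 : F))).toLinearMap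
  have hL : ∀ f, L f = Polynomial.aeval (single h (1 : F)) f * e := fun f => rfl
  have hrange : (Ideal.span {e}).restrictScalars F = LinearMap.range L := by
    ext x
    rw [Submodule.restrictScalars_mem, Ideal.mem_span_singleton', LinearMap.mem_range]
    constructor
    · rintro ⟨y, rfl⟩
      obtain ⟨f, hf⟩ := exists_aeval_mul_rowIdempotent (F := F) (p := p) hs i y
      exact ⟨f, hf.symm⟩
    · rintro ⟨f, rfl⟩
      exact ⟨_, rfl⟩
  -- A polynomial outside (Φ_{p^i}) acts invertibly on e ≠ 0, so it is not in the kernel.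
  have hker : LinearMap.ker L =
      (Ideal.span {Polynomial.cyclotomic (p ^ i) F}).restrictScalars F := by
    ext f
    rw [LinearMap.mem_ker, Submodule.restrictScalars_mem, Ideal.mem_span_singleton, hL]
    constructor
    · intro h0
      by_contra hf
      obtain ⟨y, hy⟩ := exists_mul_aeval_mul_rowIdempotent hG hp (K := K) (h := h) hi1 hirr hf
      exact hne (by rw [show e = _ from hy.symm, h0, mul_zero])
    · rintro ⟨g, rfl⟩
      rw [map_mul, mul_right_comm, aeval_cyclotomic_mul_rowIdempotent hG hp K h hi1, zero_mul]
  rw [codeDim, hrange, ← L.quotKerEquivRange.finrank_eq, hker]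
  have := finrank_quotient_span_eq_natDegree (f := Polynomial.cyclotomic (p ^ i) F)
  rw [Polynomial.natDegree_cyclotomic, Nat.totient_prime_pow hp (by omega)] at this
  exact this

theorem hasWeight_span_rowIdempotent (hG : (Nat.card G : F) ≠ 0) {p r m : ℕ} (hp : p.Prime)
    {K : Subgroup G} {h : G} (hs : IsSplitting (p ^ r) m K h) {i : ℕ} (hi1 : 1 ≤ i) (hi : i ≤ r) :
    HasWeight (Ideal.span {rowIdempotent F p K h i}) (2 * p ^ (r * (m - 1) + (r - i))) := by
  classical
  have := Fintype.ofFinite G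
  rw [← hs.card_sup hp hi, rowIdempotent_eq hG]
  have hle := sup_zpowers_le p K h i
  have hx := hs.notMem_sup hp hi1 hi
  have hx' : h ^ p ^ (i - 1) ∈ K ⊔ Subgroup.zpowers (h ^ p ^ (i - 1)) :=
    (le_sup_right : _ ≤ K ⊔ _) (Subgroup.mem_zpowers _)
  -- From here only H ≤ H', x ∈ H' and x ∉ H matter.
  generalize K ⊔ Subgroup.zpowers (h ^ p ^ i) = H at *
  generalize K ⊔ Subgroup.zpowers (h ^ p ^ (i - 1)) = H' at *
  generalize h ^ p ^ (i - 1) = x at *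
  have hcos : ∀ g : G, (Finset.univ.filter fun a : G => g⁻¹ * a ∈ H).card = Nat.card H := by
    intro g
    rw [Nat.card_eq_fintype_card, Fintype.card_subtype]
    refine Finset.card_bij (fun a _ => g⁻¹ * a) (by simp) (by simp) fun b hb => ⟨g * b, ?_, ?_⟩
    · simpa using hb
    · simp
  have hdisj : ∀ g g' : G, g⁻¹ * g' ∉ H → Disjoint (Finset.univ.filter fun a : G => g⁻¹ * a ∈ H)
      (Finset.univ.filter fun a : G => g'⁻¹ * a ∈ H) := by
    intro g g' hgg
    rw [Finset.disjoint_left]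
    intro a ha ha'
    simp only [Finset.mem_filter, Finset.mem_univ, true_and] at ha ha'
    apply hgg
    convert H.mul_mem ha (H.inv_mem ha') using 1
    group
  have hunion : ∀ g g' : G, g⁻¹ * g' ∉ H → ((Finset.univ.filter fun a : G => g⁻¹ * a ∈ H) ∪
      Finset.univ.filter fun a : G => g'⁻¹ * a ∈ H).card = 2 * Nat.card H := by
    intro g g' hgg
    rw [Finset.card_union_of_disjoint (hdisj g g' hgg), hcos, hcos, two_mul]
  constructor
  · refine ⟨hat F H - single x (1 : F) * hat F H, ?_, ?_, ?_⟩
    · rw [Ideal.mem_span_singleton']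
      refine ⟨1 - single x (1 : F), ?_⟩
      have h1 : single x (1 : F) * hat F H' = hat F H' := single_mul_hat hx'
      linear_combination h1
    · intro h0
      have h1 := congrArg (fun y => y.coeff 1) (sub_eq_zero.1 h0)
      simp only [coeff_single_one_mul, coeff_hat, mul_one] at h1
      rw [if_pos H.one_mem, if_neg (fun hh => hx (by simpa using hh))] at h1
      exact inv_ne_zero (natCast_card_subgroup_ne_zero hG _) h1
    · rw [hammingWeight, ← hunion 1 x (by simpa using hx)]
      congr 1
      ext g
      have hc := natCast_card_subgroup_ne_zero hG H
      simp only [Finsupp.mem_support_iff, coeff_sub, Finsupp.sub_apply, coeff_single_one_mul,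
        coeff_hat, Finset.mem_union, Finset.mem_filter, Finset.mem_univ, true_and, inv_one,
        one_mul]
      by_cases h1 : g ∈ H
      · have h2 : x⁻¹ * g ∉ H := fun h2 => hx (by simpa using H.mul_mem h1 (H.inv_mem h2))
        simp [h1, h2, hc, -Nat.card_eq_fintype_card]
      · by_cases h2 : x⁻¹ * g ∈ H <;> simp [h1, h2, hc, -Nat.card_eq_fintype_card]
  · rintro _ ⟨y, hy, hy0, rfl⟩
    obtain ⟨z, rfl⟩ := Ideal.mem_span_singleton'.1 hy
    set y := z * (hat F H - hat F H') with hydef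
    have hfix : H ≤ fixer y := by
      refine le_trans ?_ (fixer_mul_le _ _)
      intro k hk
      rw [mem_fixer, mul_sub, single_mul_hat hk, single_mul_hat (hle hk)]
    have hinv : ∀ g a : G, g⁻¹ * a ∈ H → y.coeff a = y.coeff g := by
      intro g a ha
      conv_lhs => rw [← mem_fixer.1 (hfix ha), coeff_single_one_mul]
      rw [mul_inv_rev, inv_inv, mul_right_comm, inv_mul_cancel, one_mul]
    have haug : augmentation y = 0 := by
      rw [hydef, map_mul, map_sub]
      have h1 : ∀ L : Subgroup G, augmentation (hat F L) = 1 := fun L =>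
        map_hat_eq_one_of_forall hG L (augmentation (F := F) (G := G)).toRingHom
          fun k _ => augmentation_single k 1
      rw [h1, h1, sub_self, mul_zero]
    obtain ⟨g, hg⟩ : ∃ g, y.coeff g ≠ 0 := by
      by_contra! hall
      exact hy0 (by ext g; simpa using hall g)
    -- With support inside the single coset gH, the coefficient sum would be |H| times the
    -- coefficient at g, which is nonzero.
    obtain ⟨g', hg', hgg'⟩ : ∃ g', y.coeff g' ≠ 0 ∧ g⁻¹ * g' ∉ H := by
      by_contra! hall
      rw [augmentation_eq_sum, ← Finset.sum_filter_add_sum_filter_not _ (fun a => g⁻¹ * a ∈ H),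
        Finset.sum_eq_zero (s := Finset.univ.filter fun a => g⁻¹ * a ∉ H), add_zero,
        Finset.sum_congr rfl (fun a ha => hinv g a (Finset.mem_filter.1 ha).2), Finset.sum_const,
        hcos, ← Nat.cast_smul_eq_nsmul F, smul_eq_mul] at haug
      · exact mul_ne_zero (natCast_card_subgroup_ne_zero hG H) hg haug
      · intro a ha
        by_contra hne
        exact (Finset.mem_filter.1 ha).2 (hall a hne)
    rw [← hunion g g' hgg']
    refine Finset.card_le_card fun a ha => ?_
    rw [Finsupp.mem_support_iff]
    rcases Finset.mem_union.1 ha with ha | ha <;> rw [hinv _ a (Finset.mem_filter.1 ha).2] <;>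
      assumption

end row

/-! ### Splittings adapted to a character -/

section coordinates

variable {G : Type*} [CommGroup G]

theorem isCompl_zpowers_ker {n : ℕ} (π : G →* Multiplicative (ZMod n)) {h : G}
    (ho : orderOf h = n) (hπ : π h = Multiplicative.ofAdd 1) :
    IsCompl (Subgroup.zpowers h) π.ker := by
  have hz : ∀ t : ℤ, π (h ^ t) = Multiplicative.ofAdd (t : ZMod n) := by
    intro t
    rw [map_zpow, hπ, ← ofAdd_zsmul, zsmul_one]
  constructor
  · rw [Subgroup.disjoint_def]
    rintro _ ⟨t, rfl⟩ ht
    rw [MonoidHom.mem_ker, hz, ofAdd_eq_one, ZMod.intCast_zmod_eq_zero_iff_dvd] at ht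
    exact orderOf_dvd_iff_zpow_eq_one.1 (ho ▸ ht)
  · rw [codisjoint_iff, eq_top_iff]
    intro x _
    obtain ⟨t, ht⟩ := ZMod.intCast_surjective (π x).toAdd
    rw [Subgroup.mem_sup]
    refine ⟨h ^ t, ⟨t, rfl⟩, (h ^ t)⁻¹ * x, ?_, mul_inv_cancel_left _ _⟩
    rw [MonoidHom.mem_ker, map_mul, map_inv, hz, ht, ofAdd_toAdd, inv_mul_cancel]

/-- The j-th basis vector h keeps its place, while each other basis vector is corrected by a power
of h to lie in the kernel of χ. Then K is the kernel of the exponent map π satisfying χ(x) =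
χ(h)^{π(x)}. -/
theorem exists_isSplitting_of_basis {n m : ℕ} [NeZero n]
    (f : G ≃* (Fin (m + 1) → Multiplicative (ZMod n))) (j : Fin (m + 1)) (c : Fin m → ℕ)
    {R : Type*} [CommMonoid R] (χ : G →* R)
    (hχ : ∀ k, χ (f.symm (Pi.mulSingle (j.succAbove k) (Multiplicative.ofAdd 1))) =
      χ (f.symm (Pi.mulSingle j (Multiplicative.ofAdd 1))) ^ c k) :
    ∃ K : Subgroup G,
      IsSplitting n (m + 1) K (f.symm (Pi.mulSingle j (Multiplicative.ofAdd 1))) ∧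
      ∀ k ∈ K, χ k = 1 := by
  set h := f.symm (Pi.mulSingle j (Multiplicative.ofAdd 1)) with hh
  let π : G →* Multiplicative (ZMod n) :=
    { toFun := fun x => f x j * ∏ k, f x (j.succAbove k) ^ c k
      map_one' := by simp
      map_mul' := fun x y => by
        simp only [map_mul, Pi.mul_apply, mul_pow, Finset.prod_mul_distrib]
        exact mul_mul_mul_comm _ _ _ _ }
  have hπ : ∀ x, π x = f x j * ∏ k, f x (j.succAbove k) ^ c k := fun _ => rfl
  have hπh : π h = Multiplicative.ofAdd 1 := by
    rw [hπ, hh, MulEquiv.apply_symm_apply, Pi.mulSingle_eq_same, Finset.prod_eq_one, mul_one]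
    intro k _
    rw [Pi.mulSingle_eq_of_ne (Fin.succAbove_ne j k), one_pow]
  have ho : orderOf h = n := by
    rw [hh, MulEquiv.orderOf_eq, orderOf_piMulSingle, orderOf_ofAdd_eq_addOrderOf,
      ZMod.addOrderOf_one]
  let θ : Multiplicative (ZMod n) →* G :=
    f.symm.toMonoidHom.comp (MonoidHom.mulSingle (fun _ => Multiplicative (ZMod n)) j)
  have hθ : θ (Multiplicative.ofAdd 1) = h := rfl
  have hcomp : (χ.comp θ).comp π = χ := by
    have hpow : ∀ x : Multiplicative (ZMod n), ∃ t : ℕ, Multiplicative.ofAdd 1 ^ t = x := by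
      intro x
      obtain ⟨t, ht⟩ := ZMod.natCast_zmod_surjective x.toAdd
      exact ⟨t, by rw [← ofAdd_nsmul, nsmul_one, ht, ofAdd_toAdd]⟩
    have hgen : ((χ.comp θ).comp π).comp f.symm.toMonoidHom = χ.comp f.symm.toMonoidHom := by
      refine MonoidHom.functions_ext _ _ _ fun l x => ?_
      obtain ⟨t, rfl⟩ := hpow x
      have hz : (Pi.mulSingle l (Multiplicative.ofAdd 1 ^ t) :
          Fin (m + 1) → Multiplicative (ZMod n)) =
          Pi.mulSingle l (Multiplicative.ofAdd 1) ^ t :=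
        map_pow (MonoidHom.mulSingle (fun _ => Multiplicative (ZMod n)) l) _ t
      rw [hz, map_pow, map_pow]
      congr 1
      change χ (θ (π (f.symm _))) = χ (f.symm _)
      obtain rfl | ⟨k, rfl⟩ := Fin.eq_self_or_eq_succAbove j l
      · rw [← hh, hπh, hθ]
      · have hne : ∀ k', k' ≠ k → j.succAbove k' ≠ j.succAbove k := fun k' hk' he =>
          hk' (Fin.succAbove_right_injective he)
        rw [hχ, hπ, MulEquiv.apply_symm_apply, Pi.mulSingle_eq_of_ne (Fin.succAbove_ne j k).symm,
          one_mul, Finset.prod_eq_single_of_mem k (Finset.mem_univ _) fun k' _ hk' => by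
            rw [Pi.mulSingle_eq_of_ne (hne k' hk'), one_pow],
          Pi.mulSingle_eq_same, map_pow, map_pow, hθ]
    ext x
    have := DFunLike.congr_fun hgen (f x)
    simpa using this
  refine ⟨π.ker, ⟨?_, ho, isCompl_zpowers_ker π ho hπh⟩, fun k hk => ?_⟩
  · let ρ : π.ker →* (Fin m → Multiplicative (ZMod n)) :=
      { toFun := fun x k => f x (j.succAbove k)
        map_one' := by ext; simp
        map_mul' := fun x y => by ext; simp }
    refine ⟨MulEquiv.ofBijective ρ ⟨?_, fun y => ?_⟩⟩
    · rw [injective_iff_map_eq_one]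
      rintro ⟨x, hx⟩ h0
      have hk : ∀ k, f x (j.succAbove k) = 1 := fun k => congrFun h0 k
      have hj : f x j = 1 := by
        rw [MonoidHom.mem_ker, hπ, Finset.prod_eq_one (fun k _ => by rw [hk, one_pow]),
          mul_one] at hx
        exact hx
      rw [Subtype.ext_iff]
      refine f.injective ?_
      rw [OneMemClass.coe_one, map_one]
      funext l
      obtain rfl | ⟨k, rfl⟩ := Fin.eq_self_or_eq_succAbove j l
      · exact hj
      · exact hk k
    -- In the kernel of π the other coordinates are free and force the j-th one.
    · refine ⟨⟨f.symm (j.insertNth (∏ k, y k ^ c k)⁻¹ y), ?_⟩, ?_⟩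
      · rw [MonoidHom.mem_ker, hπ, MulEquiv.apply_symm_apply]
        simp
      · funext k
        change f (f.symm _) (j.succAbove k) = y k
        rw [MulEquiv.apply_symm_apply, Fin.insertNth_apply_succAbove]
  · rw [← hcomp, MonoidHom.comp_apply, MonoidHom.mem_ker.1 hk, map_one]

/-- Take a basis vector whose value under χ has maximal order p^i. In a domain, that value is a
primitive root whose powers exhaust the solutions of z^{p^i} = 1, including all other basis values.
-/
theorem exists_isSplitting_of_character {p r m : ℕ} (hp : p.Prime) (hm : 0 < m)
    (hG : IsHomocyclic (p ^ r) m G) {R : Type*} [CommRing R] [IsDomain R] (χ : G →* R) :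
    ∃ (K : Subgroup G) (h : G) (i : ℕ), IsSplitting (p ^ r) m K h ∧ i ≤ r ∧
      (∀ k ∈ K, χ k = 1) ∧ orderOf (χ h) = p ^ i := by
  obtain ⟨m, rfl⟩ : ∃ k, m = k + 1 := ⟨m - 1, by omega⟩
  have : NeZero (p ^ r) := ⟨pow_ne_zero _ hp.ne_zero⟩
  obtain ⟨f⟩ := hG
  let b : Fin (m + 1) → G := fun l => f.symm (Pi.mulSingle l (Multiplicative.ofAdd 1))
  have hb : ∀ l, ∃ i ≤ r, orderOf (χ (b l)) = p ^ i := by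
    intro l
    refine (Nat.dvd_prime_pow hp).1 ((orderOf_map_dvd χ (b l)).trans ?_)
    rw [MulEquiv.orderOf_eq, orderOf_piMulSingle, orderOf_ofAdd_eq_addOrderOf,
      ZMod.addOrderOf_one]
  choose i hi ho using hb
  obtain ⟨j, hj⟩ := Finite.exists_max i
  have hroot : IsPrimitiveRoot (χ (b j)) (p ^ i j) := ho j ▸ IsPrimitiveRoot.orderOf _
  have : NeZero (p ^ i j) := ⟨pow_ne_zero _ hp.ne_zero⟩
  have hc : ∀ k, ∃ c : ℕ, χ (b (j.succAbove k)) = χ (b j) ^ c := by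
    intro k
    obtain ⟨c, -, hc⟩ := hroot.eq_pow_of_pow_eq_one (ξ := χ (b (j.succAbove k)))
      (orderOf_dvd_iff_pow_eq_one.1 (by rw [ho]; exact pow_dvd_pow p (hj _)))
    exact ⟨c, hc.symm⟩
  choose c hc using hc
  obtain ⟨K, hK, hχ⟩ := exists_isSplitting_of_basis f j c χ hc
  exact ⟨K, b j, i j, hK, hi j, hχ, ho j⟩

end coordinates

/-! ### No nonzero element is killed by every candidate -/

section completeness

variable {F : Type*} [Field F] {G : Type*} [CommGroup G] [Finite G]

theorem exists_mul_ne_zero (hc : (Nat.card G : F) ≠ 0) {p r m : ℕ} (hp : p.Prime) (hm : 0 < m)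
    (hG : IsHomocyclic (p ^ r) m G) {x : MonoidAlgebra F G} (hx : x ≠ 0) :
    x * hat F (⊤ : Subgroup G) ≠ 0 ∨
      ∃ (K : Subgroup G) (h : G) (i : ℕ), IsSplitting (p ^ r) m K h ∧ 1 ≤ i ∧ i ≤ r ∧
        x * rowIdempotent F p K h i ≠ 0 := by
  have : NeZero (p ^ r) := ⟨pow_ne_zero _ hp.ne_zero⟩
  obtain ⟨M, hM, hle⟩ := Ideal.exists_le_maximal (Submodule.annihilator (Ideal.span {x})) (by
    rw [Ne, Ideal.eq_top_iff_one, Submodule.mem_annihilator_span_singleton, one_smul]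
    exact hx)
  let φ := Ideal.Quotient.mk M
  -- Anything annihilating x lies in M, so it maps to 0.
  have hφ : ∀ y, φ y = 1 → x * y ≠ 0 := by
    intro y hy h0
    have hyM : y ∈ M :=
      hle ((Submodule.mem_annihilator_span_singleton _ _).2 (by rw [smul_eq_mul, mul_comm, h0]))
    rw [show φ y = 0 from Ideal.Quotient.eq_zero_iff_mem.2 hyM] at hy
    exact zero_ne_one hy
  obtain ⟨K, h, i, hs, hi, hK, ho⟩ :=
    exists_isSplitting_of_character hp hm hG
      ((φ : MonoidAlgebra F G →* MonoidAlgebra F G ⧸ M).comp (of F G))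
  replace hK : ∀ k ∈ K, φ (single k 1) = 1 := hK
  have hpow : ∀ t : ℕ, φ (single (h ^ t) 1) = φ (single h 1) ^ t := by
    intro t
    rw [← map_pow, single_pow, one_pow]
  change orderOf (φ (single h 1)) = p ^ i at ho
  obtain rfl | hi1 := Nat.eq_zero_or_pos i
  · left
    refine hφ _ (map_hat_eq_one_of_forall hc _ φ fun g _ => ?_)
    obtain ⟨k, hk, t, rfl⟩ := hs.exists_mul_pow g
    rw [pow_zero, orderOf_eq_one_iff] at ho
    rw [← one_mul (1 : F), ← single_mul_single, map_mul, hK k hk, hpow, ho, one_pow, one_mul]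
  · refine Or.inr ⟨K, h, i, hs, hi1, hi, hφ _ ?_⟩
    have h1 : φ (hat F (Subgroup.zpowers (h ^ p ^ i))) = 1 := by
      refine map_hat_eq_one_of_forall hc _ φ fun g hg => ?_
      obtain ⟨t, rfl⟩ := (isOfFinOrder_of_finite _).mem_powers_iff_mem_zpowers.2 hg
      change φ (single ((h ^ p ^ i) ^ t) 1) = 1
      rw [← pow_mul, hpow, pow_mul, ← ho, pow_orderOf_eq_one, one_pow]
    -- h^{p^{i-1}} fixes its own hat but has image different from 1, as h maps to an element of
    -- order p^i; in a field the hat must then vanish.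
    have h2 : φ (hat F (Subgroup.zpowers (h ^ p ^ (i - 1)))) = 0 := by
      have h3 := congrArg φ (single_mul_hat (F := F) (Subgroup.mem_zpowers (h ^ p ^ (i - 1))))
      rw [map_mul, hpow] at h3
      by_contra h0
      have h4 := orderOf_dvd_of_pow_eq_one (mul_eq_right₀ h0 |>.1 h3)
      rw [ho, Nat.pow_dvd_pow_iff_le_right hp.one_lt] at h4
      omega
    rw [rowIdempotent, map_mul, map_sub, h1, h2, map_hat_eq_one_of_forall hc K φ hK, sub_zero,
      one_mul]

end completeness

/-! ### Automorphisms and equivalence of codes -/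

section equivalence

variable {G : Type*} [CommGroup G]

/-- The product decomposition given by two complementary subgroups of an abelian group. -/
noncomputable def prodEquivOfIsCompl {H K : Subgroup G} (h : IsCompl H K) : H × K ≃* G :=
  MulEquiv.ofBijective (H.subtype.coprod K.subtype) ⟨Subgroup.mul_injective_of_disjoint h.disjoint,
    fun g => by
      have hg : g ∈ H ⊔ K := h.sup_eq_top ▸ Subgroup.mem_top g
      obtain ⟨x, hx, y, hy, rfl⟩ := Subgroup.mem_sup.1 hg
      exact ⟨(⟨x, hx⟩, ⟨y, hy⟩), rfl⟩⟩

theorem prodEquivOfIsCompl_apply {H K : Subgroup G} (h : IsCompl H K) (x : H × K) :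
    prodEquivOfIsCompl h x = x.1 * x.2 := rfl

/-- Isomorphisms ⟨h⟩ ≅ ⟨h'⟩ and K ≅ K' glue along the two direct decompositions. -/
theorem IsSplitting.exists_mulEquiv {n m : ℕ} {K K' : Subgroup G} {h h' : G}
    (hs : IsSplitting n m K h) (hs' : IsSplitting n m K' h') :
    ∃ ψ : G ≃* G, K.map ψ.toMonoidHom = K' ∧ ψ h = h' := by
  obtain ⟨⟨f⟩, ho, hc⟩ := hs
  obtain ⟨⟨f'⟩, ho', hc'⟩ := hs'
  have hgen : ∀ g : G, ∀ x : Subgroup.zpowers g,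
      x ∈ Subgroup.zpowers (⟨g, Subgroup.mem_zpowers g⟩ : Subgroup.zpowers g) := by
    rintro g ⟨_, t, rfl⟩
    exact ⟨t, rfl⟩
  let a : Subgroup.zpowers h ≃* Subgroup.zpowers h' :=
    mulEquivOfOrderOfEq (hgen h) (hgen h')
      (by rw [Subgroup.orderOf_mk, Subgroup.orderOf_mk, ho, ho'])
  have ha : a ⟨h, Subgroup.mem_zpowers h⟩ = ⟨h', Subgroup.mem_zpowers h'⟩ :=
    mulEquivOfOrderOfEq_apply_gen _ _ _
  let b : K ≃* K' := f.trans f'.symm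
  let ψ : G ≃* G := (prodEquivOfIsCompl hc).symm.trans
    ((a.prodCongr b).trans (prodEquivOfIsCompl hc'))
  have hψ : ∀ x : Subgroup.zpowers h × K, ψ (x.1 * x.2) = a x.1 * b x.2 := by
    intro x
    change prodEquivOfIsCompl hc' (a.prodCongr b ((prodEquivOfIsCompl hc).symm _)) = _
    rw [← prodEquivOfIsCompl_apply hc, MulEquiv.symm_apply_apply]
    rfl
  have hψK : ∀ k : K, ψ k = b k := fun k => by simpa using hψ (1, k)
  refine ⟨ψ, ?_, ?_⟩
  · ext g
    constructor
    · rintro ⟨k, hk, rfl⟩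
      change ψ k ∈ K'
      rw [hψK ⟨k, hk⟩]
      exact (b _).2
    · intro hg
      refine ⟨b.symm ⟨g, hg⟩, (b.symm _).2, ?_⟩
      change ψ _ = g
      rw [hψK, MulEquiv.apply_symm_apply]
  · simpa [ha] using hψ (⟨h, Subgroup.mem_zpowers h⟩, 1)

variable {F : Type*} [Field F]

theorem domCongr_image_span (ψ : G ≃* G) (e : MonoidAlgebra F G) :
    domCongr F F ψ '' (Ideal.span {e} : Ideal (MonoidAlgebra F G)) =
      (Ideal.span {domCongr F F ψ e} : Ideal (MonoidAlgebra F G)) := by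
  ext x
  simp only [Set.mem_image, SetLike.mem_coe, Ideal.mem_span_singleton']
  constructor
  · rintro ⟨_, ⟨y, rfl⟩, rfl⟩
    exact ⟨domCongr F F ψ y, (map_mul _ _ _).symm⟩
  · rintro ⟨y, rfl⟩
    exact ⟨_, ⟨(domCongr F F ψ).symm y, rfl⟩, by rw [map_mul, AlgEquiv.apply_symm_apply]⟩

theorem gEquivalent_span_rowIdempotent [Finite G] {n m p : ℕ} {K K' : Subgroup G} {h h' : G}
    (hs : IsSplitting n m K h) (hs' : IsSplitting n m K' h') (i : ℕ) :
    GEquivalent (Ideal.span {rowIdempotent F p K h i}) (Ideal.span {rowIdempotent F p K' h' i}) := by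
  obtain ⟨ψ, rfl, rfl⟩ := hs.exists_mulEquiv hs'
  exact ⟨ψ, by rw [domCongr_image_span, domCongr_rowIdempotent]⟩

theorem GEquivalent.eq_of_span_hat_top [Finite G] {I : Ideal (MonoidAlgebra F G)}
    (h : GEquivalent (Ideal.span {hat F (⊤ : Subgroup G)}) I) :
    I = Ideal.span {hat F (⊤ : Subgroup G)} := by
  obtain ⟨ψ, hψ⟩ := h
  rw [domCongr_image_span, domCongr_hat, Subgroup.map_top_of_surjective _ ψ.surjective] at hψ
  exact SetLike.coe_injective hψ.symm

theorem GEquivalent.hasWeight {I J : Ideal (MonoidAlgebra F G)} (h : GEquivalent I J) {w : ℕ}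
    (hI : HasWeight I w) : HasWeight J w := by
  obtain ⟨ψ, hψ⟩ := h
  have hw : ∀ x : MonoidAlgebra F G, hammingWeight (domCongr F F ψ x) = hammingWeight x := by
    intro x
    rw [hammingWeight, domCongr_support, Finset.card_map]
    rfl
  have hset : {k : ℕ | ∃ x ∈ J, x ≠ 0 ∧ hammingWeight x = k} =
      {k : ℕ | ∃ x ∈ I, x ≠ 0 ∧ hammingWeight x = k} := by
    ext k
    constructor
    · rintro ⟨y, hy, hy0, rfl⟩
      obtain ⟨x, hx, rfl⟩ : y ∈ domCongr F F ψ '' (I : Set _) := hψ ▸ hy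
      exact ⟨x, hx, fun h0 => hy0 (by rw [h0, map_zero]), (hw x).symm⟩
    · rintro ⟨x, hx, hx0, rfl⟩
      refine ⟨domCongr F F ψ x, ?_, by simpa using hx0, hw x⟩
      exact hψ.subset ⟨x, hx, rfl⟩
  rwa [HasWeight, hset]

end equivalence

/-! ### Primitive idempotents and minimal ideals -/

section ring

variable {R : Type*} [CommRing R]

theorem isPrimitiveIdempotent_of_isAtom {e : R} (he : IsIdempotentElem e)
    (ha : IsAtom (Ideal.span {e})) : IsPrimitiveIdempotent e := by
  refine ⟨he, by simpa using ha.1, fun a b hai hbi hab _ heab => ?_⟩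
  by_contra! hne
  have hae : a * e = a := by rw [heab, mul_add, hab, add_zero, hai]
  have hle : Ideal.span {a} ≤ Ideal.span {e} := by
    rw [Ideal.span_singleton_le_iff_mem, Ideal.mem_span_singleton']
    exact ⟨a, hae⟩
  -- Minimality gives (a) = (e), so e = ya and b = be = yab = 0.
  have heq := (ha.le_iff.1 hle).resolve_left (by simpa using hne.1)
  obtain ⟨y, hy⟩ := Ideal.mem_span_singleton'.1 (heq ▸ Ideal.mem_span_singleton_self e)
  apply hne.2
  have hbe : b * e = b := by rw [heab, mul_add, mul_comm b a, hab, zero_add, hbi]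
  rw [← hbe, ← hy]
  linear_combination y * hab

theorem IsPrimitiveIdempotent.eq_of_mul_ne_zero {e f : R} (he : IsPrimitiveIdempotent e)
    (hf : IsIdempotentElem f) (ha : IsAtom (Ideal.span {f})) (hef : e * f ≠ 0) : e = f := by
  obtain ⟨hei, -, hprim⟩ := he
  have hle : Ideal.span {e * f} ≤ Ideal.span {f} := by
    rw [Ideal.span_singleton_le_iff_mem, Ideal.mem_span_singleton']
    exact ⟨e, rfl⟩
  have heq := (ha.le_iff.1 hle).resolve_left (by simpa using hef)
  obtain ⟨y, hy⟩ := Ideal.mem_span_singleton'.1 (heq ▸ Ideal.mem_span_singleton_self f)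
  rw [IsIdempotentElem] at hei hf
  -- From f = y(ef) one gets ef = f, so e = f + (e - f) is an orthogonal decomposition.
  have hff : e * f = f := by
    linear_combination y * f * hei + (1 - e) * hy
  have h := hprim f (e - f) hf (by
      rw [IsIdempotentElem]
      linear_combination hei - 2 * hff + hf) (by linear_combination hff - hf)
    (by linear_combination hff - hf) (by ring)
  rcases h with h | h
  · exact absurd (by rw [h, mul_zero]) hef
  · exact sub_eq_zero.1 h

theorem eq_span_singleton_of_isAtom {I : Ideal R} (hI : IsAtom I) {f : R}
    (ha : IsAtom (Ideal.span {f})) {x : R} (hx : x ∈ I) (hxf : x * f ≠ 0) :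
    I = Ideal.span {f} := by
  have h1 : Ideal.span {x * f} ≤ I :=
    (Ideal.span_singleton_le_iff_mem I).2 (I.mul_mem_right f hx)
  have h2 : Ideal.span {x * f} ≤ Ideal.span {f} :=
    (Ideal.span_singleton_le_iff_mem _).2 (Ideal.mul_mem_left _ x (Ideal.mem_span_singleton_self f))
  have h0 : Ideal.span {x * f} ≠ ⊥ := by simpa using hxf
  rw [← (hI.le_iff.1 h1).resolve_left h0, ← (ha.le_iff.1 h2).resolve_left h0]

end ring

/-! ### Classification and count -/

section classification

variable {F : Type*} [Field F] {G : Type*} [CommGroup G] [Finite G]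

theorem hat_top_mul_rowIdempotent (hc : (Nat.card G : F) ≠ 0) (p : ℕ) (K : Subgroup G) (h : G)
    (i : ℕ) : hat F (⊤ : Subgroup G) * rowIdempotent F p K h i = 0 := by
  rw [rowIdempotent_eq hc, mul_sub, hat_mul_hat hc, hat_mul_hat hc, top_sup_eq, top_sup_eq,
    sub_self]

variable {p r m : ℕ} (hp : p.Prime) (hm : 0 < m) (hc : (Nat.card G : F) ≠ 0)
  (hG : IsHomocyclic (p ^ r) m G)
  (hirr : ∀ i ≤ r, Irreducible (Polynomial.cyclotomic (p ^ i) F))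

include hp hm hc hG hirr

theorem isPrimitiveIdempotent_iff (e : MonoidAlgebra F G) : IsPrimitiveIdempotent e ↔
    e = hat F (⊤ : Subgroup G) ∨ ∃ (K : Subgroup G) (h : G) (i : ℕ), IsSplitting (p ^ r) m K h ∧
      1 ≤ i ∧ i ≤ r ∧ e = rowIdempotent F p K h i := by
  constructor
  · intro he
    obtain h0 | ⟨K, h, i, hs, hi1, hi, h0⟩ := exists_mul_ne_zero hc hp hm hG he.2.1
    · exact Or.inl (he.eq_of_mul_ne_zero (isIdempotentElem_hat hc _) (isAtom_span_hat_top hc) h0)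
    · exact Or.inr ⟨K, h, i, hs, hi1, hi, he.eq_of_mul_ne_zero
        (isIdempotentElem_rowIdempotent hc p K h i)
        (isAtom_span_rowIdempotent hc hp hs hi1 hi (hirr i hi)) h0⟩
  · rintro (rfl | ⟨K, h, i, hs, hi1, hi, rfl⟩)
    · exact isPrimitiveIdempotent_of_isAtom (isIdempotentElem_hat hc _) (isAtom_span_hat_top hc)
    · exact isPrimitiveIdempotent_of_isAtom (isIdempotentElem_rowIdempotent hc p K h i)
        (isAtom_span_rowIdempotent hc hp hs hi1 hi (hirr i hi))

theorem isMinimalCode_iff (I : Ideal (MonoidAlgebra F G)) : IsMinimalCode I ↔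
    I = Ideal.span {hat F (⊤ : Subgroup G)} ∨ ∃ (K : Subgroup G) (h : G) (i : ℕ),
      IsSplitting (p ^ r) m K h ∧ 1 ≤ i ∧ i ≤ r ∧ I = Ideal.span {rowIdempotent F p K h i} := by
  constructor
  · intro hI
    obtain ⟨x, hx, hx0⟩ := Submodule.exists_mem_ne_zero_of_ne_bot hI.1
    obtain h0 | ⟨K, h, i, hs, hi1, hi, h0⟩ := exists_mul_ne_zero hc hp hm hG hx0
    · exact Or.inl (eq_span_singleton_of_isAtom hI (isAtom_span_hat_top hc) hx h0)
    · exact Or.inr ⟨K, h, i, hs, hi1, hi, eq_span_singleton_of_isAtom hI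
        (isAtom_span_rowIdempotent hc hp hs hi1 hi (hirr i hi)) hx h0⟩
  · rintro (rfl | ⟨K, h, i, hs, hi1, hi, rfl⟩)
    · exact isAtom_span_hat_top hc
    · exact isAtom_span_rowIdempotent hc hp hs hi1 hi (hirr i hi)

theorem card_quotient_minimalCodeSetoid :
    Nat.card (Quotient (minimalCodeSetoid F G)) = r + 1 := by
  -- The trivial character serves only to produce one splitting.
  obtain ⟨K, h, -, hs, -⟩ := exists_isSplitting_of_character hp hm hG (1 : G →* ℚ)
  have hrow : ∀ i : Fin r, IsMinimalCode (Ideal.span {rowIdempotent F p K h (i + 1)}) := fun i =>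
    isAtom_span_rowIdempotent hc hp hs (Nat.le_add_left 1 i) i.2 (hirr _ i.2)
  let f : Option (Fin r) → Quotient (minimalCodeSetoid F G) := fun o => match o with
    | none => Quotient.mk _ ⟨Ideal.span {hat F (⊤ : Subgroup G)}, isAtom_span_hat_top hc⟩
    | some i => Quotient.mk _ ⟨Ideal.span {rowIdempotent F p K h (i + 1)}, hrow i⟩
  have hne : ∀ i : Fin r, ¬ GEquivalent (Ideal.span {hat F (⊤ : Subgroup G)})
      (Ideal.span {rowIdempotent F p K h (i + 1)}) := by
    intro i hi
    have hmem := Ideal.mem_span_singleton_self (rowIdempotent F p K h (i + 1))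
    rw [hi.eq_of_span_hat_top, Ideal.mem_span_singleton'] at hmem
    obtain ⟨y, hy⟩ := hmem
    apply rowIdempotent_ne_zero (F := F) hc hp hs (Nat.le_add_left 1 i) i.2
    rw [← isIdempotentElem_rowIdempotent hc p K h (i + 1)]
    nth_rw 1 [← hy]
    rw [mul_assoc, hat_top_mul_rowIdempotent hc, mul_zero]
  have hf : Function.Bijective f := by
    constructor
    · rintro (_ | i) (_ | j) hij
      · rfl
      · exact absurd (Quotient.exact hij) (hne j)
      · exact absurd (GEquivalent.symm (Quotient.exact hij)) (hne i)
      · have hequiv : GEquivalent (Ideal.span {rowIdempotent F p K h (i + 1)})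
            (Ideal.span {rowIdempotent F p K h (j + 1)}) := Quotient.exact hij
        have hw := (hequiv.hasWeight (hasWeight_span_rowIdempotent hc hp hs
          (Nat.le_add_left 1 i) i.2)).unique
          (hasWeight_span_rowIdempotent hc hp hs (Nat.le_add_left 1 j) j.2)
        have hpow := Nat.pow_right_injective hp.two_le (Nat.eq_of_mul_eq_mul_left two_pos hw)
        have := i.2
        have := j.2
        congr 1
        ext
        omega
    · intro c
      induction c using Quotient.inductionOn with
      | h I =>
        obtain ⟨I, hI⟩ := I
        obtain rfl | ⟨K', h', i, hs', hi1, hi, rfl⟩ := (isMinimalCode_iff hp hm hc hG hirr I).1 hI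
        · exact ⟨none, rfl⟩
        · obtain ⟨j, rfl⟩ : ∃ j, i = j + 1 := ⟨i - 1, by omega⟩
          exact ⟨some ⟨j, hi⟩, Quotient.sound (gEquivalent_span_rowIdempotent hs hs' (j + 1))⟩
  rw [← Nat.card_eq_of_bijective f hf, Finite.card_option, Nat.card_fin]

end classification

end AbelianCodes

theorem mainTheorem11 (p r m q : ℕ) (hp : p.Prime) (hr : 0 < r) (hm : 0 < m)
    (F : Type*) [Field F] [Finite F] (hF : Nat.card F = q)
    (hq : q.Coprime (p ^ r))
    (ho : orderOf (ZMod.unitOfCoprime q hq) = Nat.totient (p ^ r))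
    (G : Type*) [CommGroup G] (hG : AbelianCodes.IsHomocyclic (p ^ r) m G) :
    -- the primitive idempotents of the group algebra
    (∀ e : MonoidAlgebra F G, AbelianCodes.IsPrimitiveIdempotent e ↔
      e = AbelianCodes.hat F (⊤ : Subgroup G) ∨
      ∃ (K : Subgroup G) (h : G) (i : ℕ), AbelianCodes.IsSplitting (p ^ r) m K h ∧
        1 ≤ i ∧ i ≤ r ∧ e = AbelianCodes.rowIdempotent F p K h i) ∧
    -- the minimal codes are exactly the ideals generated by these idempotents
    (∀ I : Ideal (MonoidAlgebra F G), AbelianCodes.IsMinimalCode I ↔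
      I = Ideal.span {AbelianCodes.hat F (⊤ : Subgroup G)} ∨
      ∃ (K : Subgroup G) (h : G) (i : ℕ), AbelianCodes.IsSplitting (p ^ r) m K h ∧
        1 ≤ i ∧ i ≤ r ∧ I = Ideal.span {AbelianCodes.rowIdempotent F p K h i}) ∧
    -- dimensions and weights
    (AbelianCodes.codeDim (Ideal.span {AbelianCodes.hat F (⊤ : Subgroup G)}) = 1 ∧
      AbelianCodes.HasWeight (Ideal.span {AbelianCodes.hat F (⊤ : Subgroup G)}) (p ^ (r * m))) ∧
    (∀ (K : Subgroup G) (h : G) (i : ℕ), AbelianCodes.IsSplitting (p ^ r) m K h →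
      1 ≤ i → i ≤ r →
      AbelianCodes.codeDim (Ideal.span {AbelianCodes.rowIdempotent F p K h i}) =
          p ^ (i - 1) * (p - 1) ∧
        AbelianCodes.HasWeight (Ideal.span {AbelianCodes.rowIdempotent F p K h i})
          (2 * p ^ (r * (m - 1) + (r - i)))) ∧
    -- the number of classes of minimal codes under `G`-equivalence
    (Nat.card (Quotient (AbelianCodes.minimalCodeSetoid F G)) = r + 1 ∧
      r + 1 = (Nat.divisors (p ^ r)).card) := by
  have : NeZero (p ^ r) := ⟨pow_ne_zero _ hp.ne_zero⟩
  have hcard : Nat.card G = p ^ (r * m) := by rw [hG.card_eq, pow_mul]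
  have : Finite G := Nat.finite_of_card_ne_zero (hcard ▸ pow_ne_zero _ hp.ne_zero)
  have hpq : q.Coprime p := (Nat.coprime_pow_right_iff hr _ _).1 hq
  -- The characteristic of F divides q, which is prime to p.
  have hc : (Nat.card G : F) ≠ 0 := by
    have := Fintype.ofFinite F
    obtain ⟨ℓ, hℓ⟩ := CharP.exists F
    obtain ⟨f, hprime, hF'⟩ := FiniteField.card F ℓ
    rw [hcard, Nat.cast_pow]
    refine pow_ne_zero _ fun h0 => ?_
    have hdvd : ℓ ∣ p := (CharP.cast_eq_zero_iff F ℓ p).1 h0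
    rw [← hF, Nat.card_eq_fintype_card, hF'] at hpq
    exact hprime.one_lt.ne' (Nat.eq_one_of_dvd_coprimes hpq (dvd_pow_self ℓ f.pos.ne') hdvd)
  have hirr : ∀ i ≤ r, Irreducible (Polynomial.cyclotomic (p ^ i) F) := fun i hi =>
    AbelianCodes.irreducible_cyclotomic_of_orderOf hF (hpq.pow_right i)
      (AbelianCodes.orderOf_unitOfCoprime_of_dvd (pow_dvd_pow p hi) hq _ ho)
  refine ⟨AbelianCodes.isPrimitiveIdempotent_iff hp hm hc hG hirr,
    AbelianCodes.isMinimalCode_iff hp hm hc hG hirr,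
    ⟨AbelianCodes.codeDim_span_hat_top hc, hcard ▸ AbelianCodes.hasWeight_span_hat_top hc⟩,
    fun K h i hs hi1 hi =>
      ⟨AbelianCodes.codeDim_span_rowIdempotent hc hp hs hi1 hi (hirr i hi),
        AbelianCodes.hasWeight_span_rowIdempotent hc hp hs hi1 hi⟩,
    AbelianCodes.card_quotient_minimalCodeSetoid hp hm hc hG hirr, ?_⟩
  rw [Nat.divisors_prime_pow hp, Finset.card_map, Finset.card_range]
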